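/- Let $(x^i,y^i)_{i=1}^N$ be training pairs, let $\mathcal Y(x)$ be the finite set of feasible labellings of an input $x$, let $f(x,y)\in\mathbb R^K$ be a feature vector, $\Delta f_i(y)=f(x^i,y^i)-f(x^i,y)$, and let $\Delta\ell_i(y)\in\mathbb R$ be a loss (for example the Hamming loss). Let $\lambda>0$, $C\ge 0$, and let $p_0(w)=\prod_{k=1}^K\frac{\sqrt\lambda}{2}e^{-\sqrt\lambda|w_k|}$ be the Laplace prior on $\mathbb R^K$. The Laplace MaxEnDNet is the problem of minimizing $$KL(p\,\|\,p_0)+C\sum_{i=1}^N\xi_i$$ over probability distributions $p$ on $\mathbb R^K$ and $\xi\in\mathbb R^N$ with $\xi_i\ge0$ for all $i$ and $\int p(w)\,[\,w^\top\Delta f_i(y)-\Delta\ell_i(y)\,]\,dw\ge-\xi_i$ (the integrals being finite) for all $i$ and all $y\in\mathcal Y(x^i)$ with $y\ne y^i$. For $\mu\in\mathbb R^K$ put $$\|\mu\|_{KL}=\sum_{k=1}^K\Big(\sqrt{\mu_k^2+\tfrac1\lambda}-\tfrac1{\sqrt\lambda}\log\frac{\sqrt{\lambda\mu_k^2+1}+1}{2}\Big).$$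 Then the problem has a solution, and the posterior distribution $p$ (the $p$-component of a solution) is unique. Its mean is obtained by solving the primal problem $$\min_{\mu,\xi}\ \sqrt\lambda\,\|\mu\|_{KL}+C\sum_{i=1}^N\xi_i\quad\text{s.t.}\quad \mu^\top\Delta f_i(y)\ge\Delta\ell_i(y)-\xi_i,\ \ \xi_i\ge0,\quad\forall i,\ \forall y\in\mathcal Y(x^i),\ y\ne y^i,$$ in the following sense: if $(p,\xi)$ solves the Laplace MaxEnDNet problem, then $p$ has a mean $\mu$ and $(\mu,\xi)$ solves the primal problem; conversely, if $(\mu,\xi)$ solves the primal problem, then there is a $p$ with mean $\mu$ such that $(p,\xi)$ solves the Laplace MaxEnDNet problem. Moreover the posterior is a tilted Laplace distribution $p_\eta(w)\propto p_0(w)e^{w^\top\eta}$ for some $\eta\in\mathbb R^K$ with $\eta_k^2<\lambda$ for all $k$; and for every such $\eta$, $p_\eta$ has a mean $\mu$ and $$\sqrt\lambda\,\|\mu\|_{KL}=KL(p_\eta\,\|\,p_0)+K.$$ -/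

import Mathlib

open MeasureTheory

noncomputable section

namespace MaxEnDNet

/-- The weight space `ℝ^K`. -/
abbrev Weights (K : ℕ) : Type := Fin K → ℝ

/-- The data of a structured prediction task: `N` training pairs `(x^i, y^i)`, the finite set
`𝒴(x)` of feasible labellings of each input `x`, and the loss `Δℓ_i(y)` of the labelling `y`
with respect to the `i`-th training pair. The loss is arbitrary; the Hamming loss is a
special case. -/
structure Data (X Y : Type*) (N : ℕ) where
  input : Fin N → X
  output : Fin N → Y
  labels : X → Finset Y
  loss : Fin N → Y → ℝ

variable {X Y : Type*} {N K : ℕ}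

/-- The margin `ΔF_i(y; w) = F(x^i, y^i; w) - F(x^i, y; w)`. -/
def marginF (D : Data X Y N) (F : X → Y → Weights K → ℝ) (i : Fin N) (y : Y)
    (w : Weights K) : ℝ :=
  F (D.input i) (D.output i) w - F (D.input i) y w

/-- The feasible set of weight distributions for the slack vector `ξ`: probability measures
`p` under which all margins are integrable and
`∫ (ΔF_i(y; w) - Δℓ_i(y)) dp(w) ≥ -ξ_i` for all `i` and all feasible `y ≠ y^i`. -/
def feasibleDistributions (D : Data X Y N) (F : X → Y → Weights K → ℝ) (ξ : Fin N → ℝ) :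
    Set (Measure (Weights K)) :=
  {p | IsProbabilityMeasure p ∧
    ∀ i, ∀ y ∈ D.labels (D.input i), y ≠ D.output i →
      Integrable (marginF D F i y) p ∧
        -ξ i ≤ ∫ w, (marginF D F i y w - D.loss i y) ∂p}

/-- The feasible pairs `(p, ξ)` of the MaxEnDNet problem. -/
def feasible (D : Data X Y N) (F : X → Y → Weights K → ℝ) :
    Set (Measure (Weights K) × (Fin N → ℝ)) :=
  {q | q.1 ∈ feasibleDistributions D F q.2 ∧ ∀ i, 0 ≤ q.2 i}

/-- The MaxEnDNet objective `KL(p ‖ p₀) + U(ξ)`. -/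
def objective (p₀ : Measure (Weights K)) (U : (Fin N → ℝ) → ℝ)
    (q : Measure (Weights K) × (Fin N → ℝ)) : EReal :=
  (InformationTheory.klDiv q.1 p₀ : EReal) + (U q.2 : EReal)

/-- `(p, ξ)` solves the MaxEnDNet problem
`min KL(p ‖ p₀) + U(ξ)` subject to the expected margin constraints and `ξ ≥ 0`. -/
def IsSolution (D : Data X Y N) (F : X → Y → Weights K → ℝ) (p₀ : Measure (Weights K))
    (U : (Fin N → ℝ) → ℝ) (p : Measure (Weights K)) (ξ : Fin N → ℝ) : Prop :=
  (p, ξ) ∈ feasible D F ∧ IsMinOn (objective p₀ U) (feasible D F) (p, ξ)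

/-- The linear discriminant function `F(x, y; w) = wᵀ f(x, y)`. -/
def linearF (f : X → Y → Weights K) (x : X) (y : Y) (w : Weights K) : ℝ :=
  w ⬝ᵥ f x y

/-- The linear slack penalty `U(ξ) = C ∑ ξ_i`. -/
def linearSlack (C : ℝ) (ξ : Fin N → ℝ) : ℝ :=
  C * ∑ i, ξ i

/-- The Laplace prior, with density `∏_k (√lam / 2) exp (-√lam |w_k|)`. -/
def laplacePrior (K : ℕ) (lam : ℝ) : Measure (Weights K) :=
  (volume : Measure (Weights K)).withDensity fun w =>
    ENNReal.ofReal (∏ k, √lam / 2 * Real.exp (-√lam * |w k|))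

/-- `(p, ξ)` solves the Laplace MaxEnDNet problem; then `p` is the posterior distribution. -/
def IsLaplaceSolution (D : Data X Y N) (f : X → Y → Weights K) (lam C : ℝ)
    (p : Measure (Weights K)) (ξ : Fin N → ℝ) : Prop :=
  IsSolution D (linearF f) (laplacePrior K lam) (linearSlack C) p ξ

/-- `μ` is the mean of `p`, all coordinates being integrable. -/
def HasMean (p : Measure (Weights K)) (μ : Weights K) : Prop :=
  ∀ k, Integrable (fun w : Weights K => w k) p ∧ ∫ w, w k ∂p = μ k

/-- The KL-norm
`∑_k (√(μ_k² + 1/lam) - (1/√lam) log ((√(lam μ_k² + 1) + 1) / 2))`. -/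
def klNorm (lam : ℝ) (μ : Weights K) : ℝ :=
  ∑ k, (√(μ k ^ 2 + 1 / lam) - 1 / √lam * Real.log ((√(lam * μ k ^ 2 + 1) + 1) / 2))

/-- `Δf_i(y) = f(x^i, y^i) - f(x^i, y)`. -/
def featureDiff (D : Data X Y N) (f : X → Y → Weights K) (i : Fin N) (y : Y) : Weights K :=
  f (D.input i) (D.output i) - f (D.input i) y

/-- The feasible pairs `(μ, ξ)` of the primal problem. -/
def primalFeasible (D : Data X Y N) (f : X → Y → Weights K) :
    Set (Weights K × (Fin N → ℝ)) :=
  {q | (∀ i, ∀ y ∈ D.labels (D.input i), y ≠ D.output i →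
      q.1 ⬝ᵥ featureDiff D f i y ≥ D.loss i y - q.2 i) ∧ ∀ i, 0 ≤ q.2 i}

/-- The primal objective `√lam ‖μ‖_KL + C ∑ ξ_i`. -/
def primalObjective (lam C : ℝ) (q : Weights K × (Fin N → ℝ)) : ℝ :=
  √lam * klNorm lam q.1 + C * ∑ i, q.2 i

/-- `(μ, ξ)` solves the primal problem. -/
def IsPrimalSolution (D : Data X Y N) (f : X → Y → Weights K) (lam C : ℝ)
    (μ : Weights K) (ξ : Fin N → ℝ) : Prop :=
  (μ, ξ) ∈ primalFeasible D f ∧ IsMinOn (primalObjective lam C) (primalFeasible D f) (μ, ξ)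

/-- The tilted Laplace distribution `p(w) ∝ p₀(w) exp (wᵀ η)`. -/
def tiltedLaplace (lam : ℝ) (η : Weights K) : Measure (Weights K) :=
  (laplacePrior K lam).tilted fun w => w ⬝ᵥ η

end MaxEnDNet

end

/-! Write `Λ` for the cumulant generating function of the prior `p₀`. If `p` has mean `μ` and finite
divergence from `p₀`, then `KL(p‖p₀) = KL(p‖p_η) + μ·η - Λ(η)` for every admissible tilt `η`
(`klDiv_laplacePrior_eq`). Taking the tilt whose mean is `μ` turns the last two terms into `√lam
‖μ‖_KL - K` (`dotProduct_meanTilt_sub_laplaceCGF`). The margin constraints see `p` only through `μ`,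
so among distributions of mean `μ` the tilted Laplace is the unique optimum, and minimizing over `μ`
is the primal problem.

A finite divergence forces a mean to exist, by Young's inequality and the exponential moments of
`p₀`. The primal problem has a solution because, with the slack eliminated, its objective is
continuous and coercive. Its `μ` is unique by strict convexity, which comes from the same identity
with the tilt held fixed. -/

namespace MaxEnDNet

/-! ### Exponential moments of the Laplace density on the line. -/

/-- The density `a / 2 * exp (-a * |x|)` of the Laplace distribution on the line. -/
noncomputable def laplaceDensity (a x : ℝ) : ℝ :=
  a / 2 * Real.exp (-a * |x|)

theorem integrable_and_integral_eq_of_Ioi {g : ℝ → ℝ} (h₁ : IntegrableOn g (Set.Ioi 0))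
    (h₂ : IntegrableOn (fun x => g (-x)) (Set.Ioi 0)) :
    Integrable g ∧ ∫ x, g x = (∫ x in Set.Ioi 0, g x) + ∫ x in Set.Ioi 0, g (-x) := by
  have h₃ : IntegrableOn g (Set.Iio 0) := by
    rw [← (Measure.measurePreserving_neg (volume : Measure ℝ)).integrableOn_comp_preimage
      (Homeomorph.neg ℝ).measurableEmbedding]
    simpa [Function.comp_def] using h₂
  have h₄ : IntegrableOn g (Set.Iic 0) := (integrableOn_Iic_iff_integrableOn_Iio (by finiteness)).2 h₃
  refine ⟨?_, ?_⟩
  · rw [← integrableOn_univ, ← Set.Iic_union_Ioi (a := (0 : ℝ))]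
    exact h₄.union h₁
  · rw [← intervalIntegral.integral_Iic_add_Ioi h₄ h₁, add_comm,
      integral_comp_neg_Ioi (f := g), neg_zero]

theorem integrableOn_mul_exp_neg_mul_Ioi {b : ℝ} (hb : 0 < b) :
    IntegrableOn (fun x : ℝ => x * Real.exp (-b * x)) (Set.Ioi 0) := by
  simpa using integrableOn_rpow_mul_exp_neg_mul_rpow (p := 1) (s := 1) (by norm_num) one_pos hb

theorem integral_mul_exp_neg_mul_Ioi {b : ℝ} (hb : 0 < b) :
    ∫ x in Set.Ioi (0 : ℝ), x * Real.exp (-b * x) = 1 / b ^ 2 := by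
  have h := Real.integral_rpow_mul_exp_neg_mul_Ioi (a := 2) two_pos hb
  rw [show (2 : ℝ) - 1 = 1 by norm_num] at h
  simpa using h

theorem integral_exp_neg_mul_Ioi {b : ℝ} (hb : 0 < b) :
    ∫ x in Set.Ioi (0 : ℝ), Real.exp (-b * x) = 1 / b := by
  rw [integral_exp_mul_Ioi (neg_neg_of_pos hb)]
  simp

theorem laplaceDensity_mul_exp_of_pos {a t x : ℝ} (hx : 0 < x) :
    laplaceDensity a x * Real.exp (x * t) = a / 2 * Real.exp (-(a - t) * x) := by
  rw [laplaceDensity, mul_assoc, ← Real.exp_add, abs_of_pos hx]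
  ring_nf

theorem laplaceDensity_neg_mul_exp_of_pos {a t x : ℝ} (hx : 0 < x) :
    laplaceDensity a (-x) * Real.exp (-x * t) = a / 2 * Real.exp (-(a + t) * x) := by
  rw [laplaceDensity, mul_assoc, ← Real.exp_add, abs_neg, abs_of_pos hx]
  ring_nf

theorem integrable_and_integral_laplaceDensity_mul_exp {a t : ℝ} (h₁ : 0 < a - t)
    (h₂ : 0 < a + t) :
    Integrable (fun x => laplaceDensity a x * Real.exp (x * t)) ∧
      ∫ x, laplaceDensity a x * Real.exp (x * t) = a ^ 2 / (a ^ 2 - t ^ 2) := by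
  have e₁ : Set.EqOn (fun x => laplaceDensity a x * Real.exp (x * t))
      (fun x => a / 2 * Real.exp (-(a - t) * x)) (Set.Ioi 0) :=
    fun x hx => laplaceDensity_mul_exp_of_pos hx
  have e₂ : Set.EqOn (fun x => laplaceDensity a (-x) * Real.exp (-x * t))
      (fun x => a / 2 * Real.exp (-(a + t) * x)) (Set.Ioi 0) :=
    fun x hx => laplaceDensity_neg_mul_exp_of_pos hx
  have i₁ := (integrableOn_exp_mul_Ioi (neg_neg_of_pos h₁) 0).const_mul (a / 2)
  have i₂ := (integrableOn_exp_mul_Ioi (neg_neg_of_pos h₂) 0).const_mul (a / 2)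
  obtain ⟨hi, he⟩ := integrable_and_integral_eq_of_Ioi
    (IntegrableOn.congr_fun i₁ e₁.symm measurableSet_Ioi)
    (IntegrableOn.congr_fun i₂ e₂.symm measurableSet_Ioi)
  refine ⟨hi, ?_⟩
  rw [he, setIntegral_congr_fun measurableSet_Ioi e₁, setIntegral_congr_fun measurableSet_Ioi e₂,
    integral_const_mul, integral_const_mul, integral_exp_neg_mul_Ioi h₁,
    integral_exp_neg_mul_Ioi h₂, show a ^ 2 - t ^ 2 = (a - t) * (a + t) by ring]
  field_simp
  ring

theorem integrable_and_integral_laplaceDensity_mul_exp_mul_self {a t : ℝ} (h₁ : 0 < a - t)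
    (h₂ : 0 < a + t) :
    Integrable (fun x => laplaceDensity a x * (Real.exp (x * t) * x)) ∧
      ∫ x, laplaceDensity a x * (Real.exp (x * t) * x) =
        a ^ 2 / (a ^ 2 - t ^ 2) * (2 * t / (a ^ 2 - t ^ 2)) := by
  have e₁ : Set.EqOn (fun x => laplaceDensity a x * (Real.exp (x * t) * x))
      (fun x => a / 2 * (x * Real.exp (-(a - t) * x))) (Set.Ioi 0) := fun x hx => by
    have := laplaceDensity_mul_exp_of_pos (a := a) (t := t) hx
    linear_combination x * this
  have e₂ : Set.EqOn (fun x => laplaceDensity a (-x) * (Real.exp (-x * t) * -x))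
      (fun x => -(a / 2) * (x * Real.exp (-(a + t) * x))) (Set.Ioi 0) := fun x hx => by
    have := laplaceDensity_neg_mul_exp_of_pos (a := a) (t := t) hx
    linear_combination (-x) * this
  have i₁ := (integrableOn_mul_exp_neg_mul_Ioi h₁).const_mul (a / 2)
  have i₂ := (integrableOn_mul_exp_neg_mul_Ioi h₂).const_mul (-(a / 2))
  obtain ⟨hi, he⟩ := integrable_and_integral_eq_of_Ioi
    (IntegrableOn.congr_fun i₁ e₁.symm measurableSet_Ioi)
    (IntegrableOn.congr_fun i₂ e₂.symm measurableSet_Ioi)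
  refine ⟨hi, ?_⟩
  rw [he, setIntegral_congr_fun measurableSet_Ioi e₁, setIntegral_congr_fun measurableSet_Ioi e₂,
    integral_const_mul, integral_const_mul, integral_mul_exp_neg_mul_Ioi h₁,
    integral_mul_exp_neg_mul_Ioi h₂, show a ^ 2 - t ^ 2 = (a - t) * (a + t) by ring]
  field_simp
  ring

/-! ### The Laplace prior and its tilts: normalization and means. -/

variable {K : ℕ} {lam : ℝ}

theorem integrable_and_integral_laplacePrior_prod {g : Fin K → ℝ → ℝ}
    (hg : ∀ k, Integrable fun x => laplaceDensity √lam x * g k x) :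
    Integrable (fun w : Weights K => ∏ k, g k (w k)) (laplacePrior K lam) ∧
      ∫ w, ∏ k, g k (w k) ∂laplacePrior K lam = ∏ k, ∫ x, laplaceDensity √lam x * g k x := by
  have hm : Measurable fun w : Weights K =>
      ENNReal.ofReal (∏ k, √lam / 2 * Real.exp (-√lam * |w k|)) := by fun_prop
  have hc : ∀ w : Weights K,
      (ENNReal.ofReal (∏ k, √lam / 2 * Real.exp (-√lam * |w k|))).toReal • ∏ k, g k (w k) =
        ∏ k, laplaceDensity √lam (w k) * g k (w k) := fun w => by
    rw [ENNReal.toReal_ofReal (by positivity), smul_eq_mul, ← Finset.prod_mul_distrib]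
    rfl
  have hf : ∀ᵐ w : Weights K,
      ENNReal.ofReal (∏ k, √lam / 2 * Real.exp (-√lam * |w k|)) < ⊤ :=
    ae_of_all _ fun _ => ENNReal.ofReal_lt_top
  rw [laplacePrior, integrable_withDensity_iff_integrable_smul' hm hf,
    integral_withDensity_eq_integral_toReal_smul hm hf]
  simp only [hc]
  exact ⟨Integrable.fintype_prod hg, integral_fintype_prod_volume_eq_prod
    fun k x => laplaceDensity √lam x * g k x⟩

theorem sqrt_sub_pos_and_add_pos {t : ℝ} (ht : t ^ 2 < lam) : 0 < √lam - t ∧ 0 < √lam + t := by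
  have := abs_lt.1 (Real.lt_sqrt (abs_nonneg t) |>.2 (by rwa [sq_abs]))
  constructor <;> linarith

theorem integrable_and_integral_exp_dotProduct_laplacePrior {η : Weights K}
    (hη : ∀ k, η k ^ 2 < lam) :
    Integrable (fun w : Weights K => Real.exp (w ⬝ᵥ η)) (laplacePrior K lam) ∧
      ∫ w : Weights K, Real.exp (w ⬝ᵥ η) ∂laplacePrior K lam = ∏ k, lam / (lam - η k ^ 2) := by
  have h := fun k => integrable_and_integral_laplaceDensity_mul_exp
    (sqrt_sub_pos_and_add_pos (hη k)).1 (sqrt_sub_pos_and_add_pos (hη k)).2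
  obtain ⟨hi, he⟩ := integrable_and_integral_laplacePrior_prod fun k => (h k).1
  simp only [dotProduct, Real.exp_sum]
  refine ⟨hi, he.trans (Finset.prod_congr rfl fun k _ => ?_)⟩
  rw [(h k).2, Real.sq_sqrt ((sq_nonneg _).trans (hη k).le)]

theorem isProbabilityMeasure_laplacePrior (hlam : 0 < lam) :
    IsProbabilityMeasure (laplacePrior K lam) := by
  have h := integrable_and_integral_exp_dotProduct_laplacePrior (K := K) (lam := lam) (η := 0)
    (by simp [hlam])
  simp only [dotProduct_zero, Real.exp_zero] at h
  have : IsFiniteMeasure (laplacePrior K lam) :=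
    (integrable_const_iff_isFiniteMeasure one_ne_zero).1 h.1
  have h₂ := h.2
  simp only [integral_const, smul_eq_mul, mul_one, Pi.zero_apply, ne_eq, OfNat.ofNat_ne_zero,
    not_false_eq_true, zero_pow, sub_zero, div_self hlam.ne', Finset.prod_const_one] at h₂
  exact isProbabilityMeasure_iff_real.2 h₂

theorem integrable_and_integral_exp_dotProduct_mul_laplacePrior {η : Weights K}
    (hη : ∀ k, η k ^ 2 < lam) (k : Fin K) :
    Integrable (fun w : Weights K => Real.exp (w ⬝ᵥ η) * w k) (laplacePrior K lam) ∧
      ∫ w : Weights K, Real.exp (w ⬝ᵥ η) * w k ∂laplacePrior K lam =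
        (∏ k, lam / (lam - η k ^ 2)) * (2 * η k / (lam - η k ^ 2)) := by
  have hs := fun j => sqrt_sub_pos_and_add_pos (hη j)
  have h := fun j => integrable_and_integral_laplaceDensity_mul_exp (hs j).1 (hs j).2
  have h' := integrable_and_integral_laplaceDensity_mul_exp_mul_self (hs k).1 (hs k).2
  have hl : 0 ≤ lam := (sq_nonneg _).trans (hη k).le
  -- Absorbing the factor `w k` into the `k`-th coordinate keeps the integrand a product.
  obtain ⟨hi, he⟩ := integrable_and_integral_laplacePrior_prod (lam := lam)
    (g := fun j x => Real.exp (x * η j) * if j = k then x else 1) fun j => by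
      by_cases hj : j = k
      · subst hj; simpa using h'.1
      · simpa [hj] using (h j).1
  simp only [Finset.prod_mul_distrib, Finset.prod_ite_eq', Finset.mem_univ, if_true,
    ← Real.exp_sum] at hi he
  refine ⟨hi, he.trans ?_⟩
  calc _ = ∏ j, lam / (lam - η j ^ 2) * if j = k then 2 * η j / (lam - η j ^ 2) else 1 := by
        refine Finset.prod_congr rfl fun j _ => ?_
        by_cases hj : j = k
        · subst hj
          simp only [if_true, h'.2, Real.sq_sqrt hl]
        · simp only [hj, if_false, mul_one, (h j).2, Real.sq_sqrt hl]
    _ = _ := by rw [Finset.prod_mul_distrib, Finset.prod_ite_eq', if_pos (Finset.mem_univ k)]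

theorem hasMean_tiltedLaplace (hlam : 0 < lam) {η : Weights K} (hη : ∀ k, η k ^ 2 < lam) :
    HasMean (tiltedLaplace lam η) fun k => 2 * η k / (lam - η k ^ 2) := by
  intro k
  have h := integrable_and_integral_exp_dotProduct_laplacePrior hη
  have h' := integrable_and_integral_exp_dotProduct_mul_laplacePrior hη k
  have hp : ∏ k, lam / (lam - η k ^ 2) ≠ 0 :=
    Finset.prod_ne_zero_iff.2 fun j _ => div_ne_zero hlam.ne' (sub_pos.2 (hη j)).ne'
  refine ⟨(integrable_tilted_iff h.1 _).2 h'.1, ?_⟩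
  rw [tiltedLaplace, integral_tilted]
  simp only [smul_eq_mul, div_mul_eq_mul_div]
  rw [integral_div, h.2, h'.2, mul_div_cancel_left₀ _ hp]

theorem isProbabilityMeasure_tiltedLaplace (hlam : 0 < lam) {η : Weights K}
    (hη : ∀ k, η k ^ 2 < lam) : IsProbabilityMeasure (tiltedLaplace lam η) :=
  have := isProbabilityMeasure_laplacePrior (K := K) hlam
  isProbabilityMeasure_tilted (integrable_and_integral_exp_dotProduct_laplacePrior hη).1

end MaxEnDNet
namespace MaxEnDNet
-- Finite divergence, means, and the divergence identity.
open InformationTheory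

/-- Young's inequality: the convex conjugate of `klFun` is `exp t - 1`. It will be applied with `r`
a density and `t = |f|`. -/
theorem mul_le_klFun_add_exp {r : ℝ} (hr : 0 ≤ r) (t : ℝ) : r * t ≤ klFun r + Real.exp t := by
  rw [klFun_apply]
  rcases hr.eq_or_lt with rfl | hr
  · simp; positivity
  · have h := Real.add_one_le_exp (t - Real.log r)
    rw [Real.exp_sub, Real.exp_log hr, le_div_iff₀ hr] at h
    linarith

/-- A function with an exponential moment under `ν` is integrable under every measure of finite
Kullback-Leibler divergence from `ν`. -/
theorem integrable_of_klDiv_ne_top {α : Type*} {mα : MeasurableSpace α} {μ ν : Measure α}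
    [IsFiniteMeasure μ] [IsFiniteMeasure ν] (h : klDiv μ ν ≠ ⊤) {f : α → ℝ}
    (hf : AEStronglyMeasurable f ν) (hexp : Integrable (fun x => Real.exp |f x|) ν) :
    Integrable f μ := by
  obtain ⟨hac, hint⟩ := klDiv_ne_top_iff.1 h
  rw [← integrable_rnDeriv_smul_iff hac]
  refine (((integrable_klFun_rnDeriv_iff hac).2 hint).add hexp).mono'
    ((μ.measurable_rnDeriv ν).ennreal_toReal.aestronglyMeasurable.smul hf) (ae_of_all _ fun x => ?_)
  rw [norm_smul, Real.norm_of_nonneg ENNReal.toReal_nonneg, Real.norm_eq_abs]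
  exact mul_le_klFun_add_exp ENNReal.toReal_nonneg _

variable {K : ℕ} {lam : ℝ}

theorem exists_hasMean_of_klDiv_ne_top (hlam : 0 < lam) {p : Measure (Weights K)}
    [IsProbabilityMeasure p] (h : klDiv p (laplacePrior K lam) ≠ ⊤) : ∃ μ, HasMean p μ := by
  have := isProbabilityMeasure_laplacePrior (K := K) hlam
  refine ⟨fun k => ∫ w, w k ∂p, fun k => ⟨?_, rfl⟩⟩
  -- Any scale strictly between `0` and `√lam` would do: the exponential moments at `c` and `-c`
  -- together dominate `exp |c * w k|`.
  have hc : 0 < √lam / 2 := by positivity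
  have hsq : (√lam / 2) ^ 2 < lam := by
    rw [div_pow, Real.sq_sqrt hlam.le]
    linarith
  have key : ∀ c : ℝ, c ^ 2 < lam →
      Integrable (fun w : Weights K => Real.exp (w k * c)) (laplacePrior K lam) := fun c hc => by
    have := (integrable_and_integral_exp_dotProduct_laplacePrior (lam := lam)
      (η := Pi.single k c) fun j => by
        by_cases hj : j = k
        · subst hj; simpa using hc
        · simpa [Pi.single_eq_of_ne hj] using hlam).1
    simpa only [dotProduct_single] using this
  have hi : Integrable (fun w : Weights K => w k * (√lam / 2)) p := by
    refine integrable_of_klDiv_ne_top h (Measurable.aestronglyMeasurable (by fun_prop)) ?_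
    refine ((key _ hsq).add (key (-(√lam / 2)) (by rwa [neg_sq]))).mono'
      (Measurable.aestronglyMeasurable (by fun_prop)) (ae_of_all _ fun w => ?_)
    rw [Real.norm_of_nonneg (Real.exp_pos _).le, Pi.add_apply, mul_neg]
    rcases abs_cases (w k * (√lam / 2)) with h | h <;> rw [h.1]
    · linarith [Real.exp_pos (-(w k * (√lam / 2)))]
    · linarith [Real.exp_pos (w k * (√lam / 2))]
  simpa only [mul_assoc, mul_inv_cancel₀ hc.ne', mul_one] using hi.mul_const (√lam / 2)⁻¹

theorem HasMean.integrable_dotProduct {p : Measure (Weights K)} {μ : Weights K}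
    (h : HasMean p μ) (v : Weights K) : Integrable (fun w : Weights K => w ⬝ᵥ v) p :=
  integrable_finsetSum _ fun k _ => (h k).1.mul_const (v k)

theorem HasMean.integral_dotProduct {p : Measure (Weights K)} {μ : Weights K}
    (h : HasMean p μ) (v : Weights K) : ∫ w : Weights K, w ⬝ᵥ v ∂p = μ ⬝ᵥ v := by
  simp only [dotProduct]
  rw [integral_finsetSum _ fun k _ => (h k).1.mul_const (v k)]
  exact Finset.sum_congr rfl fun k _ => by rw [integral_mul_const, (h k).2]

theorem HasMean.unique {p : Measure (Weights K)} {μ ν : Weights K} (h : HasMean p μ)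
    (h' : HasMean p ν) : μ = ν :=
  funext fun k => (h k).2.symm.trans (h' k).2

/-- The cumulant generating function of the Laplace prior. -/
noncomputable def laplaceCGF (lam : ℝ) (η : Weights K) : ℝ :=
  ∑ k, Real.log (lam / (lam - η k ^ 2))

theorem log_integral_exp_dotProduct_laplacePrior (hlam : 0 < lam) {η : Weights K}
    (hη : ∀ k, η k ^ 2 < lam) :
    Real.log (∫ w : Weights K, Real.exp (w ⬝ᵥ η) ∂laplacePrior K lam) = laplaceCGF lam η := by
  rw [(integrable_and_integral_exp_dotProduct_laplacePrior hη).2, laplaceCGF,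
    Real.log_prod fun k _ => div_ne_zero hlam.ne' (sub_pos.2 (hη k)).ne']

/-- The log-density of the tilt relative to the prior is `w·η - Λ(η)`; integrate it against `p`. The
tilt need not match the mean of `p`, a freedom used for strict convexity. -/
theorem klDiv_laplacePrior_eq (hlam : 0 < lam) {η : Weights K} (hη : ∀ k, η k ^ 2 < lam)
    {p : Measure (Weights K)} [IsProbabilityMeasure p] (h : klDiv p (laplacePrior K lam) ≠ ⊤)
    {μ : Weights K} (hμ : HasMean p μ) :
    klDiv p (tiltedLaplace lam η) ≠ ⊤ ∧ (klDiv p (laplacePrior K lam)).toReal =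
      (klDiv p (tiltedLaplace lam η)).toReal + (μ ⬝ᵥ η - laplaceCGF lam η) := by
  have := isProbabilityMeasure_laplacePrior (K := K) hlam
  have := isProbabilityMeasure_tiltedLaplace hlam hη
  obtain ⟨hac, hint⟩ := klDiv_ne_top_iff.1 h
  have hexp := (integrable_and_integral_exp_dotProduct_laplacePrior hη).1
  have hac' : p ≪ tiltedLaplace lam η := hac.trans (absolutelyContinuous_tilted hexp)
  refine ⟨klDiv_ne_top hac'
    (integrable_llr_tilted_right hac (hμ.integrable_dotProduct η) hint hexp), ?_⟩
  have hi := integral_llr_tilted_right hac (hμ.integrable_dotProduct η) hexp hint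
  rw [log_integral_exp_dotProduct_laplacePrior hlam hη, hμ.integral_dotProduct] at hi
  rw [toReal_klDiv_of_measure_eq hac (by simp), toReal_klDiv_of_measure_eq hac' (by simp),
    tiltedLaplace, hi]
  ring

theorem klDiv_tiltedLaplace_ne_top (hlam : 0 < lam) {η : Weights K} (hη : ∀ k, η k ^ 2 < lam) :
    klDiv (tiltedLaplace lam η) (laplacePrior K lam) ≠ ⊤ := by
  have := isProbabilityMeasure_laplacePrior (K := K) hlam
  have := isProbabilityMeasure_tiltedLaplace hlam hη
  have hexp := (integrable_and_integral_exp_dotProduct_laplacePrior hη).1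
  have hac := tilted_absolutelyContinuous (laplacePrior K lam) fun w => w ⬝ᵥ η
  refine klDiv_ne_top hac ?_
  have he := hac.ae_le (log_rnDeriv_tilted_left_self hexp)
  exact (integrable_congr he).2
    (((hasMean_tiltedLaplace hlam hη).integrable_dotProduct η).sub (integrable_const _))

theorem toReal_klDiv_tiltedLaplace (hlam : 0 < lam) {η : Weights K} (hη : ∀ k, η k ^ 2 < lam)
    {μ : Weights K} (hμ : HasMean (tiltedLaplace lam η) μ) :
    (klDiv (tiltedLaplace lam η) (laplacePrior K lam)).toReal = μ ⬝ᵥ η - laplaceCGF lam η := by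
  have := isProbabilityMeasure_tiltedLaplace hlam hη
  simpa using (klDiv_laplacePrior_eq hlam hη (klDiv_tiltedLaplace_ne_top hlam hη) hμ).2

/-! ### The inverse mean map and the KL-norm as a Legendre transform. -/

/-- The tilt for which the tilted Laplace distribution has mean `μ`. -/
noncomputable def meanTilt (lam : ℝ) (μ : Weights K) : Weights K :=
  -- The root of `2η / (lam - η²) = μ` with `η² < lam`, rationalized so that it also makes sense at
  -- `μ = 0`.
  fun k => lam * μ k / (1 + √(lam * μ k ^ 2 + 1))

theorem sub_meanTilt_sq (hlam : 0 < lam) (μ : Weights K) (k : Fin K) :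
    lam - meanTilt lam μ k ^ 2 = 2 * lam / (1 + √(lam * μ k ^ 2 + 1)) := by
  have hs : √(lam * μ k ^ 2 + 1) ^ 2 = lam * μ k ^ 2 + 1 := Real.sq_sqrt (by positivity)
  have hp : 0 < 1 + √(lam * μ k ^ 2 + 1) := by positivity
  rw [meanTilt]
  field_simp
  linear_combination hs

theorem meanTilt_sq_lt (hlam : 0 < lam) (μ : Weights K) (k : Fin K) :
    meanTilt lam μ k ^ 2 < lam := by
  have : 0 < lam - meanTilt lam μ k ^ 2 := by
    rw [sub_meanTilt_sq hlam]
    positivity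
  linarith

theorem hasMean_tiltedLaplace_meanTilt (hlam : 0 < lam) (μ : Weights K) :
    HasMean (tiltedLaplace lam (meanTilt lam μ)) μ := by
  convert hasMean_tiltedLaplace hlam (meanTilt_sq_lt hlam μ) using 1
  funext k
  rw [sub_meanTilt_sq hlam, meanTilt]
  have hp : 0 < 1 + √(lam * μ k ^ 2 + 1) := by positivity
  field_simp

theorem sqrt_mul_klNorm (hlam : 0 < lam) (μ : Weights K) :
    √lam * klNorm lam μ =
      ∑ k, (√(lam * μ k ^ 2 + 1) - Real.log ((√(lam * μ k ^ 2 + 1) + 1) / 2)) := by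
  rw [klNorm, Finset.mul_sum]
  refine Finset.sum_congr rfl fun k _ => ?_
  have hs : √lam ≠ 0 := (Real.sqrt_pos.2 hlam).ne'
  rw [mul_sub, ← Real.sqrt_mul hlam.le, ← mul_assoc, mul_one_div_cancel hs, one_mul]
  congr 3
  field_simp

/-- With `s = √(lam μ² + 1)`, each coordinate has `μ η = s - 1` and `lam / (lam - η²) = (s + 1) /
2`; the terms `-1` add up to `-K`. -/
theorem dotProduct_meanTilt_sub_laplaceCGF (hlam : 0 < lam) (μ : Weights K) :
    μ ⬝ᵥ meanTilt lam μ - laplaceCGF lam (meanTilt lam μ) = √lam * klNorm lam μ - K := by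
  rw [sqrt_mul_klNorm hlam, dotProduct, laplaceCGF, ← Finset.sum_sub_distrib,
    show (K : ℝ) = ∑ _k : Fin K, (1 : ℝ) by simp, ← Finset.sum_sub_distrib]
  refine Finset.sum_congr rfl fun k _ => ?_
  have hs : √(lam * μ k ^ 2 + 1) ^ 2 = lam * μ k ^ 2 + 1 := Real.sq_sqrt (by positivity)
  have hp : 0 < 1 + √(lam * μ k ^ 2 + 1) := by positivity
  have h₁ : μ k * meanTilt lam μ k = √(lam * μ k ^ 2 + 1) - 1 := by
    rw [meanTilt, mul_div_assoc', div_eq_iff hp.ne']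
    linear_combination -hs
  have h₂ : lam / (lam - meanTilt lam μ k ^ 2) = (√(lam * μ k ^ 2 + 1) + 1) / 2 := by
    rw [sub_meanTilt_sq hlam]
    field_simp
    ring
  rw [h₁, h₂]
  ring

theorem meanTilt_mean_tiltedLaplace (hlam : 0 < lam) {η : Weights K} (hη : ∀ k, η k ^ 2 < lam) :
    (meanTilt lam fun k => 2 * η k / (lam - η k ^ 2)) = η := by
  funext k
  have hd : 0 < lam - η k ^ 2 := sub_pos.2 (hη k)
  have hs : √(lam * (2 * η k / (lam - η k ^ 2)) ^ 2 + 1) = (lam + η k ^ 2) / (lam - η k ^ 2) := by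
    rw [Real.sqrt_eq_iff_eq_sq (by positivity) (by positivity)]
    field_simp
    ring
  rw [meanTilt, hs]
  field_simp
  ring

theorem coe_klDiv_tiltedLaplace_add (hlam : 0 < lam) {η : Weights K} (hη : ∀ k, η k ^ 2 < lam) :
    ∃ μ, HasMean (tiltedLaplace lam η) μ ∧
      (klDiv (tiltedLaplace lam η) (laplacePrior K lam) : EReal) + ((K : ℝ) : EReal) =
        ((√lam * klNorm lam μ : ℝ) : EReal) := by
  refine ⟨_, hasMean_tiltedLaplace hlam hη, ?_⟩
  have h := toReal_klDiv_tiltedLaplace hlam hη (hasMean_tiltedLaplace hlam hη)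
  have h' := dotProduct_meanTilt_sub_laplaceCGF hlam fun k => 2 * η k / (lam - η k ^ 2)
  rw [meanTilt_mean_tiltedLaplace hlam hη] at h'
  rw [← EReal.coe_ennreal_toReal (klDiv_tiltedLaplace_ne_top hlam hη), h, h']
  norm_cast
  ring

end MaxEnDNet
namespace MaxEnDNet
open InformationTheory

/-! ### Reduction of the distributional problem to the primal problem. -/

variable {X Y : Type*} {N K : ℕ} {lam C : ℝ} {D : Data X Y N} {f : X → Y → Weights K}

theorem marginF_linearF (D : Data X Y N) (f : X → Y → Weights K) (i : Fin N) (y : Y) :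
    marginF D (linearF f) i y = fun w => w ⬝ᵥ featureDiff D f i y := by
  funext w
  rw [featureDiff, dotProduct_sub]
  rfl

theorem mem_feasible_iff_mem_primalFeasible {p : Measure (Weights K)} [IsProbabilityMeasure p]
    {μ : Weights K} (hμ : HasMean p μ) (ξ : Fin N → ℝ) :
    (p, ξ) ∈ feasible D (linearF f) ↔ (μ, ξ) ∈ primalFeasible D f := by
  refine and_congr_left fun _ => ⟨fun h i y hy hne => ?_, fun h => ⟨‹_›, fun i y hy hne => ?_⟩⟩
  · have := (h.2 i y hy hne).2
    rw [marginF_linearF, integral_sub (hμ.integrable_dotProduct _) (integrable_const _),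
      hμ.integral_dotProduct] at this
    simp only [integral_const, probReal_univ, one_smul] at this
    linarith
  · have := h i y hy hne
    rw [marginF_linearF, integral_sub (hμ.integrable_dotProduct _) (integrable_const _),
      hμ.integral_dotProduct]
    simp only [integral_const, probReal_univ, one_smul]
    exact ⟨hμ.integrable_dotProduct _, by linarith⟩

theorem objective_eq_klDiv_add_primalObjective (hlam : 0 < lam) {p : Measure (Weights K)}
    [IsProbabilityMeasure p] (h : klDiv p (laplacePrior K lam) ≠ ⊤) {μ : Weights K}
    (hμ : HasMean p μ) (ξ : Fin N → ℝ) :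
    klDiv p (tiltedLaplace lam (meanTilt lam μ)) ≠ ⊤ ∧
    objective (laplacePrior K lam) (linearSlack C) (p, ξ) =
      (((klDiv p (tiltedLaplace lam (meanTilt lam μ))).toReal +
        (primalObjective lam C (μ, ξ) - K) : ℝ) : EReal) := by
  obtain ⟨h₁, h₂⟩ := klDiv_laplacePrior_eq hlam (meanTilt_sq_lt hlam μ) h hμ
  refine ⟨h₁, ?_⟩
  rw [objective, ← EReal.coe_ennreal_toReal h, h₂, dotProduct_meanTilt_sub_laplaceCGF hlam,
    ← EReal.coe_add, linearSlack, primalObjective]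
  congr 1
  ring

theorem objective_tiltedLaplace_meanTilt (hlam : 0 < lam) (μ : Weights K) (ξ : Fin N → ℝ) :
    objective (laplacePrior K lam) (linearSlack C) (tiltedLaplace lam (meanTilt lam μ), ξ) =
      ((primalObjective lam C (μ, ξ) - K : ℝ) : EReal) := by
  have := isProbabilityMeasure_tiltedLaplace hlam (meanTilt_sq_lt hlam μ)
  simpa using (objective_eq_klDiv_add_primalObjective (C := C) hlam
    (klDiv_tiltedLaplace_ne_top hlam (meanTilt_sq_lt hlam μ))
    (hasMean_tiltedLaplace_meanTilt hlam μ) ξ).2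

/-- A competitor of finite divergence costs at least the primal value at its mean, less `K`, since
the residual divergence is nonnegative; the matched tilt attains this bound. -/
theorem IsPrimalSolution.isLaplaceSolution (hlam : 0 < lam) {μ : Weights K} {ξ : Fin N → ℝ}
    (h : IsPrimalSolution D f lam C μ ξ) :
    IsLaplaceSolution D f lam C (tiltedLaplace lam (meanTilt lam μ)) ξ := by
  have := isProbabilityMeasure_tiltedLaplace hlam (meanTilt_sq_lt hlam μ)
  refine ⟨(mem_feasible_iff_mem_primalFeasible
    (hasMean_tiltedLaplace_meanTilt hlam μ) ξ).2 h.1, fun ⟨q, ζ⟩ hq => ?_⟩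
  have : IsProbabilityMeasure q := hq.1.1
  rw [Set.mem_ofPred_eq, objective_tiltedLaplace_meanTilt hlam]
  by_cases htop : klDiv q (laplacePrior K lam) = ⊤
  · rw [objective, htop, EReal.coe_ennreal_top, EReal.top_add_coe]
    exact le_top
  obtain ⟨ν, hν⟩ := exists_hasMean_of_klDiv_ne_top hlam htop
  rw [(objective_eq_klDiv_add_primalObjective hlam htop hν ζ).2, EReal.coe_le_coe_iff]
  have hle : primalObjective lam C (μ, ξ) ≤ primalObjective lam C (ν, ζ) :=
    h.2 ((mem_feasible_iff_mem_primalFeasible hν ζ).1 hq)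
  linarith [ENNReal.toReal_nonneg (a := klDiv q (tiltedLaplace lam (meanTilt lam ν)))]

/-! ### Existence of a primal solution. -/

open Classical in
/-- The least slack vector that makes the weight vector `μ` feasible. -/
noncomputable def leastSlack (D : Data X Y N) (f : X → Y → Weights K) (μ : Weights K)
    (i : Fin N) : NNReal :=
  -- Working in `NNReal` builds in `ξ i ≥ 0`; an empty supremum is `0`.
  ((D.labels (D.input i)).filter (· ≠ D.output i)).sup fun y =>
    (D.loss i y - μ ⬝ᵥ featureDiff D f i y).toNNReal

open Classical in
theorem mem_primalFeasible_iff {μ : Weights K} {ξ : Fin N → ℝ} :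
    (μ, ξ) ∈ primalFeasible D f ↔ ∀ i, (leastSlack D f μ i : ℝ) ≤ ξ i := by
  constructor
  · rintro ⟨h₁, h₂⟩ i
    rw [← Real.le_toNNReal_iff_coe_le (h₂ i), leastSlack, Finset.sup_le_iff]
    intro y hy
    obtain ⟨hy, hne⟩ := Finset.mem_filter.1 hy
    have h₃ : μ ⬝ᵥ featureDiff D f i y ≥ D.loss i y - ξ i := h₁ i y hy hne
    exact Real.toNNReal_le_toNNReal (by linarith)
  · refine fun h => ⟨fun i y hy hne => ?_, fun i => (NNReal.coe_nonneg _).trans (h i)⟩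
    have h₁ : (D.loss i y - μ ⬝ᵥ featureDiff D f i y).toNNReal ≤ leastSlack D f μ i :=
      Finset.le_sup (f := fun y => (D.loss i y - μ ⬝ᵥ featureDiff D f i y).toNNReal)
        (Finset.mem_filter.2 ⟨hy, hne⟩)
    have h₂ := (Real.toNNReal_le_iff_le_coe.1 h₁).trans (h i)
    simp only
    linarith

theorem continuous_leastSlack (i : Fin N) : Continuous fun μ => leastSlack D f μ i := by
  refine Continuous.finset_sup_apply fun y _ => continuous_real_toNNReal.comp ?_
  exact continuous_const.sub (continuous_id.dotProduct continuous_const)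

/-- Coercivity: `log t ≤ t - 1` at `t = (s + 1) / 2` bounds each summand `s - log t` below by `(s +
1) / 2`, which is positive and grows linearly. -/
theorem abs_le_sqrt_mul_klNorm (hlam : 0 < lam) (μ : Weights K) (k : Fin K) :
    √lam / 2 * |μ k| ≤ √lam * klNorm lam μ := by
  have hle : ∀ j, (√(lam * μ j ^ 2 + 1) + 1) / 2 ≤
      √(lam * μ j ^ 2 + 1) - Real.log ((√(lam * μ j ^ 2 + 1) + 1) / 2) := fun j => by
    have := Real.log_le_sub_one_of_pos
      (show 0 < (√(lam * μ j ^ 2 + 1) + 1) / 2 by positivity)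
    linarith
  have h₁ : √lam * |μ k| ≤ √(lam * μ k ^ 2 + 1) := by
    rw [← Real.sqrt_sq_eq_abs, ← Real.sqrt_mul hlam.le]
    exact Real.sqrt_le_sqrt (by linarith)
  rw [sqrt_mul_klNorm hlam]
  calc √lam / 2 * |μ k| ≤ (√(lam * μ k ^ 2 + 1) + 1) / 2 := by linarith
    _ ≤ _ := hle k
    _ ≤ _ := Finset.single_le_sum
      (f := fun j => √(lam * μ j ^ 2 + 1) - Real.log ((√(lam * μ j ^ 2 + 1) + 1) / 2))
      (fun j _ => (show 0 ≤ (√(lam * μ j ^ 2 + 1) + 1) / 2 by positivity).trans (hle j))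
      (Finset.mem_univ k)

theorem continuous_sqrt_mul_klNorm (hlam : 0 < lam) :
    Continuous fun μ : Weights K => √lam * klNorm lam μ := by
  simp only [sqrt_mul_klNorm hlam]
  refine continuous_finsetSum _ fun k _ => ?_
  refine Continuous.sub (by fun_prop) (Continuous.log (by fun_prop) fun μ => ?_)
  positivity

theorem klNorm_zero (hlam : 0 < lam) : √lam * klNorm lam (0 : Weights K) = K := by
  simp [sqrt_mul_klNorm hlam]

theorem exists_isPrimalSolution (hlam : 0 < lam) (hC : 0 ≤ C) (D : Data X Y N)
    (f : X → Y → Weights K) : ∃ μ ξ, IsPrimalSolution D f lam C μ ξ := by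
  set g : Weights K → ℝ := fun μ =>
    √lam * klNorm lam μ + C * ∑ i, (leastSlack D f μ i : ℝ) with hg
  have hcont : Continuous g := (continuous_sqrt_mul_klNorm hlam).add
    (continuous_const.mul (continuous_finsetSum _ fun i _ =>
      NNReal.continuous_coe.comp (continuous_leastSlack i)))
  have hev : ∀ᶠ μ in Filter.cocompact (Weights K), g 0 ≤ g μ := by
    have hs : 0 < √lam := Real.sqrt_pos.2 hlam
    have hg₀ : 0 ≤ g 0 := by
      rw [hg]
      simp only [klNorm_zero hlam]
      positivity
    filter_upwards [tendsto_norm_cocompact_atTop.eventually_ge_atTop (g 0 / (√lam / 2))]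
      with μ hμ
    by_contra! hlt
    have hslack : 0 ≤ C * ∑ i, (leastSlack D f μ i : ℝ) := by positivity
    -- The sup-norm criterion below needs a positive radius. Since `g 0 ≥ K`, only `K = 0` could
    -- fail, and then the weight space is a point.
    have hpos : 0 < g 0 := by
      by_contra! h0
      have hz : g 0 = 0 := le_antisymm h0 hg₀
      have hK : (K : ℝ) = 0 := by
        have : (K : ℝ) ≤ g 0 := by
          rw [hg]
          simp only [klNorm_zero hlam]
          linarith [show 0 ≤ C * ∑ i, (leastSlack D f 0 i : ℝ) by positivity]
        exact le_antisymm (this.trans hz.le) (Nat.cast_nonneg K)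
      have : K = 0 := by exact_mod_cast hK
      subst this
      exact hlt.ne (congrArg g (Subsingleton.elim _ _))
    have : ‖μ‖ < g 0 / (√lam / 2) := by
      rw [pi_norm_lt_iff (by positivity)]
      intro k
      rw [lt_div_iff₀ (by positivity), Real.norm_eq_abs, mul_comm]
      have h₁ := abs_le_sqrt_mul_klNorm hlam μ k
      have h₂ : g μ = √lam * klNorm lam μ + C * ∑ i, (leastSlack D f μ i : ℝ) := rfl
      linarith
    exact this.not_ge hμ
  obtain ⟨μ, hμ⟩ := hcont.exists_forall_le' 0 hev
  refine ⟨μ, fun i => leastSlack D f μ i, mem_primalFeasible_iff.2 fun _ => le_rfl,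
    fun ⟨ν, ζ⟩ hν => ?_⟩
  refine (hμ ν).trans ?_
  have := Finset.sum_le_sum fun i (_ : i ∈ Finset.univ) => mem_primalFeasible_iff.1 hν i
  exact add_le_add_right (mul_le_mul_of_nonneg_left this hC) _

/-! ### From posteriors back to primal solutions, and uniqueness. -/

theorem IsLaplaceSolution.exists_isPrimalSolution (hlam : 0 < lam) {p : Measure (Weights K)}
    {ξ : Fin N → ℝ} (h : IsLaplaceSolution D f lam C p ξ) :
    ∃ μ, HasMean p μ ∧ IsPrimalSolution D f lam C μ ξ ∧
      p = tiltedLaplace lam (meanTilt lam μ) := by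
  have : IsProbabilityMeasure p := h.1.1.1
  have hle : ∀ ν ζ, (ν, ζ) ∈ primalFeasible D f →
      objective (laplacePrior K lam) (linearSlack C) (p, ξ) ≤
        ((primalObjective lam C (ν, ζ) - K : ℝ) : EReal) := fun ν ζ hν => by
    have := isProbabilityMeasure_tiltedLaplace hlam (meanTilt_sq_lt hlam ν)
    rw [← objective_tiltedLaplace_meanTilt hlam]
    exact h.2 ((mem_feasible_iff_mem_primalFeasible
      (hasMean_tiltedLaplace_meanTilt hlam ν) ζ).2 hν)
  have htop : klDiv p (laplacePrior K lam) ≠ ⊤ := fun htop => by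
    have := hle 0 (fun i => leastSlack D f 0 i) (mem_primalFeasible_iff.2 fun _ => le_rfl)
    rw [objective, htop, EReal.coe_ennreal_top, EReal.top_add_coe, top_le_iff] at this
    exact EReal.coe_ne_top _ this
  obtain ⟨μ, hμ⟩ := exists_hasMean_of_klDiv_ne_top hlam htop
  obtain ⟨htop', heq⟩ := objective_eq_klDiv_add_primalObjective (C := C) hlam htop hμ ξ
  have := isProbabilityMeasure_tiltedLaplace hlam (meanTilt_sq_lt hlam μ)
  have hfeas := (mem_feasible_iff_mem_primalFeasible hμ ξ).1 h.1
  simp only [heq, EReal.coe_le_coe_iff] at hle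
  refine ⟨μ, hμ, ⟨hfeas, fun ⟨ν, ζ⟩ hν => ?_⟩, ?_⟩
  · have := hle ν ζ hν
    rw [Set.mem_ofPred_eq]
    linarith [ENNReal.toReal_nonneg (a := klDiv p (tiltedLaplace lam (meanTilt lam μ)))]
  -- Comparing `p` with the tilt of the same mean leaves no room for a positive residual divergence.
  · have h₀ := hle μ ξ hfeas
    have h₁ : (klDiv p (tiltedLaplace lam (meanTilt lam μ))).toReal = 0 :=
      le_antisymm (by linarith) ENNReal.toReal_nonneg
    exact klDiv_eq_zero_iff.1 (((ENNReal.toReal_eq_zero_iff _).1 h₁).resolve_right htop')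

/-- The affine function given by the tilt at `ν` supports the KL-norm at `ν`. The gap at `μ` is the
divergence between the two tilts, positive because their means differ. -/
theorem dotProduct_sub_laplaceCGF_lt (hlam : 0 < lam) {μ ν : Weights K} (hne : μ ≠ ν) :
    μ ⬝ᵥ meanTilt lam ν - laplaceCGF lam (meanTilt lam ν) < √lam * klNorm lam μ - K := by
  have hη := meanTilt_sq_lt hlam μ
  have := isProbabilityMeasure_tiltedLaplace hlam hη
  have := isProbabilityMeasure_tiltedLaplace hlam (meanTilt_sq_lt hlam ν)
  have hμ := hasMean_tiltedLaplace_meanTilt hlam μ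
  obtain ⟨h₁, h₂⟩ := klDiv_laplacePrior_eq hlam (meanTilt_sq_lt hlam ν)
    (klDiv_tiltedLaplace_ne_top hlam hη) hμ
  rw [toReal_klDiv_tiltedLaplace hlam hη hμ, dotProduct_meanTilt_sub_laplaceCGF hlam] at h₂
  have hpos : 0 < (klDiv (tiltedLaplace lam (meanTilt lam μ))
      (tiltedLaplace lam (meanTilt lam ν))).toReal := by
    refine ENNReal.toReal_pos (fun h₀ => hne ?_) h₁
    rw [klDiv_eq_zero_iff.1 h₀] at hμ
    exact hμ.unique (hasMean_tiltedLaplace_meanTilt hlam ν)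
  linarith

/-- Evaluate the supporting affine function at the midpoint at both endpoints and average. -/
theorem klNorm_midpoint_lt (hlam : 0 < lam) {μ ν : Weights K} (hne : μ ≠ ν) :
    √lam * klNorm lam ((2⁻¹ : ℝ) • (μ + ν)) <
      2⁻¹ * (√lam * klNorm lam μ + √lam * klNorm lam ν) := by
  set m : Weights K := (2⁻¹ : ℝ) • (μ + ν) with hm
  have hm₂ : μ + ν = m + m := by
    rw [hm, ← add_smul]
    norm_num
  have h₁ : μ ≠ m := fun h => hne (by rw [h] at hm₂ ⊢; exact (add_left_cancel hm₂).symm)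
  have h₂ : ν ≠ m := fun h => h₁ (by rw [h] at hm₂; exact add_right_cancel hm₂)
  have h₃ := dotProduct_sub_laplaceCGF_lt hlam h₁
  have h₄ := dotProduct_sub_laplaceCGF_lt hlam h₂
  have h₅ := dotProduct_meanTilt_sub_laplaceCGF hlam m
  have h₆ := congrArg (· ⬝ᵥ meanTilt lam m) hm₂
  simp only [add_dotProduct] at h₆
  linarith

/-- Otherwise the midpoint of the two solutions would be feasible and strictly better. Only `μ` is
determined: for `C = 0` the slacks can be enlarged freely. -/
theorem IsPrimalSolution.unique (hlam : 0 < lam) {μ ν : Weights K} {ξ ζ : Fin N → ℝ}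
    (h : IsPrimalSolution D f lam C μ ξ) (h' : IsPrimalSolution D f lam C ν ζ) : μ = ν := by
  by_contra hne
  have hfeas : ((2⁻¹ : ℝ) • (μ + ν), (2⁻¹ : ℝ) • (ξ + ζ)) ∈ primalFeasible D f := by
    refine ⟨fun i y hy hy' => ?_, fun i => ?_⟩
    · have h₁ := h.1.1 i y hy hy'
      have h₂ := h'.1.1 i y hy hy'
      simp only [smul_dotProduct, add_dotProduct, Pi.smul_apply, Pi.add_apply, smul_eq_mul]
        at h₁ h₂ ⊢
      linarith
    · have h₁ := h.1.2 i
      have h₂ := h'.1.2 i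
      simp only [Pi.smul_apply, Pi.add_apply, smul_eq_mul] at h₁ h₂ ⊢
      linarith
  have h₁ := h.2 hfeas
  have h₂ := h'.2 hfeas
  have h₃ := klNorm_midpoint_lt hlam hne
  simp only [Set.mem_ofPred_eq, primalObjective, Pi.smul_apply, Pi.add_apply, smul_eq_mul,
    ← Finset.mul_sum, Finset.sum_add_distrib] at h₁ h₂
  linarith

end MaxEnDNet

theorem corollary6 {X Y : Type*} {N K : ℕ} (D : MaxEnDNet.Data X Y N)
    (f : X → Y → MaxEnDNet.Weights K) {lam C : ℝ} (hlam : 0 < lam) (hC : 0 ≤ C) :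
    -- the posterior distribution exists and is unique
    (∃! p : MeasureTheory.Measure (MaxEnDNet.Weights K),
      ∃ ξ : Fin N → ℝ, MaxEnDNet.IsLaplaceSolution D f lam C p ξ) ∧
    -- its mean is obtained by solving the primal problem
    (∀ (p : MeasureTheory.Measure (MaxEnDNet.Weights K)) (ξ : Fin N → ℝ),
      MaxEnDNet.IsLaplaceSolution D f lam C p ξ →
        ∃ μ, MaxEnDNet.HasMean p μ ∧ MaxEnDNet.IsPrimalSolution D f lam C μ ξ) ∧
    (∀ (μ : MaxEnDNet.Weights K) (ξ : Fin N → ℝ),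
      MaxEnDNet.IsPrimalSolution D f lam C μ ξ →
        ∃ p, MaxEnDNet.IsLaplaceSolution D f lam C p ξ ∧ MaxEnDNet.HasMean p μ) ∧
    -- the posterior is a tilted Laplace distribution
    (∀ (p : MeasureTheory.Measure (MaxEnDNet.Weights K)) (ξ : Fin N → ℝ),
      MaxEnDNet.IsLaplaceSolution D f lam C p ξ →
        ∃ η : MaxEnDNet.Weights K, (∀ k, η k ^ 2 < lam) ∧
          p = MaxEnDNet.tiltedLaplace lam η) ∧
    -- the regularizer is `KL(p ‖ p₀) + K` for every tilted Laplace distribution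
    (∀ η : MaxEnDNet.Weights K, (∀ k, η k ^ 2 < lam) →
      ∃ μ, MaxEnDNet.HasMean (MaxEnDNet.tiltedLaplace lam η) μ ∧
        (InformationTheory.klDiv (MaxEnDNet.tiltedLaplace lam η)
            (MaxEnDNet.laplacePrior K lam) : EReal) + ((K : ℝ) : EReal) =
          ((√lam * MaxEnDNet.klNorm lam μ : ℝ) : EReal)) := by
  refine ⟨?_, fun p ξ h => ?_, fun μ ξ h => ?_, fun p ξ h => ?_, fun η hη =>
    MaxEnDNet.coe_klDiv_tiltedLaplace_add hlam hη⟩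
  · obtain ⟨μ, ξ, h⟩ := MaxEnDNet.exists_isPrimalSolution hlam hC D f
    refine ⟨_, ⟨ξ, h.isLaplaceSolution hlam⟩, fun q ⟨ζ, hq⟩ => ?_⟩
    -- Every posterior is the tilt determined by its mean, so uniqueness of the primal `μ` suffices.
    obtain ⟨ν, -, hν, rfl⟩ := hq.exists_isPrimalSolution hlam
    rw [h.unique hlam hν]
  · obtain ⟨μ, hμ, hsol, -⟩ := h.exists_isPrimalSolution hlam
    exact ⟨μ, hμ, hsol⟩
  · exact ⟨_, h.isLaplaceSolution hlam, MaxEnDNet.hasMean_tiltedLaplace_meanTilt hlam μ⟩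
  · obtain ⟨μ, -, -, hp⟩ := h.exists_isPrimalSolution hlam
    exact ⟨_, MaxEnDNet.meanTilt_sq_lt hlam μ, hp⟩
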